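/- Let $1<p<\infty$, $p'=p/(p-1)$. A weight on $\mathbb R^n$ is a measurable function $w:\mathbb R^n\to[0,\infty]$ with $0<w<\infty$ almost everywhere. For $1<q<\infty$, $q'=q/(q-1)$, a weight $w$ belongs to $A_q$ if \[ [w]_{A_q}=\sup_Q\left(\frac1{|Q|}\int_Q w\,dx\right)\left(\frac1{|Q|}\int_Q w^{1-q'}\,dx\right)^{q-1}<\infty, \] where the supremum is taken over all cubes $Q\subset\mathbb R^n$ with sides parallel to the coordinate axes, and $A_\infty=\bigcup_{1<q<\infty}A_q$. If $w$ is a weight such that $w\in A_\infty$ and $w^{1-p'}\in A_\infty$, then $w\in A_p$. -/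

import Mathlib

open MeasureTheory
open scoped ENNReal

noncomputable section

namespace Muckenhoupt

/-- The closed cube in `ℝⁿ` with sides parallel to the coordinate axes, lower corner `a` and
side length `ℓ`. -/
def cube {n : ℕ} (a : Fin n → ℝ) (ℓ : ℝ) : Set (Fin n → ℝ) :=
  Set.Icc a (fun i => a i + ℓ)

/-- A weight on `ℝⁿ`: a (Lebesgue) measurable function with values in `(0, ∞)` almost everywhere.
Local integrability is not imposed here; it is a consequence of the finiteness of `apConst`. -/
structure IsWeight {n : ℕ} (w : (Fin n → ℝ) → ℝ≥0∞) : Prop where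
  aemeasurable : AEMeasurable w volume
  pos : ∀ᵐ x ∂(volume : Measure (Fin n → ℝ)), 0 < w x
  lt_top : ∀ᵐ x ∂(volume : Measure (Fin n → ℝ)), w x < ∞

/-- The constant `[w]_{A_p} = sup_Q (⨍_Q w) (⨍_Q w^{1-p'})^{p-1}`, with values in `[0, ∞]`; the
supremum is over all nondegenerate cubes with sides parallel to the axes. -/
def apConst {n : ℕ} (p : ℝ) (w : (Fin n → ℝ) → ℝ≥0∞) : ℝ≥0∞ :=
  ⨆ (a : Fin n → ℝ) (ℓ : ℝ) (_ : 0 < ℓ),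
    (⨍⁻ x in cube a ℓ, w x ∂volume) *
      (⨍⁻ x in cube a ℓ, w x ^ (1 - Real.conjExponent p) ∂volume) ^ (p - 1)

/-- The Muckenhoupt class `A_p` (used for `1 < p < ∞`). -/
def MemAp {n : ℕ} (p : ℝ) (w : (Fin n → ℝ) → ℝ≥0∞) : Prop :=
  IsWeight w ∧ apConst p w < ∞

/-- The class `A_∞`, the union of the classes `A_q` over `1 < q < ∞`. -/
def MemAInfty {n : ℕ} (w : (Fin n → ℝ) → ℝ≥0∞) : Prop :=
  ∃ q : ℝ, 1 < q ∧ MemAp q w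

end Muckenhoupt

end

namespace Muckenhoupt

/-! With `σ = w ^ (1 - p')`, multiply on each cube the `A_q` product of `w` by the `(p - 1)`-th
power of the `A_r` product of `σ`. This gives the `A_p` product of `w` times an `L^s` mean of `w`
and an `L^t` mean of `w⁻¹`, whose product is at least `1` by Hölder. -/

/-- On a probability space, the `L^s` mean of a weight times the `L^t` mean of its reciprocal is
at least `1`, for all exponents `s, t > 0`. -/
lemma one_le_lintegral_rpow_mul_lintegral_rpow_neg {Ω : Type*} [MeasurableSpace Ω]
    {μ : Measure Ω} [IsProbabilityMeasure μ] {w : Ω → ℝ≥0∞} (hw : AEMeasurable w μ)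
    (hpos : ∀ᵐ x ∂μ, 0 < w x) (hfin : ∀ᵐ x ∂μ, w x < ∞) {s t : ℝ} (hs : 0 < s) (ht : 0 < t) :
    1 ≤ (∫⁻ x, w x ^ s ∂μ) ^ s⁻¹ * (∫⁻ x, w x ^ (-t) ∂μ) ^ t⁻¹ := by
  have hst : 0 < s + t := add_pos hs ht
  -- These Hölder weights sum to `1` and cancel the powers of `w`.
  have key := ENNReal.lintegral_mul_norm_pow_le (μ := μ) (hw.pow_const s) (hw.pow_const (-t))
    (p := t / (s + t)) (q := s / (s + t)) (by positivity) (by positivity) (by field_simp; ring)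
  have hone : ∫⁻ x, (w x ^ s) ^ (t / (s + t)) * (w x ^ (-t)) ^ (s / (s + t)) ∂μ = 1 := by
    rw [← measure_univ (μ := μ), ← lintegral_one]
    refine lintegral_congr_ae ?_
    filter_upwards [hpos, hfin] with x h0 h1
    rw [← ENNReal.rpow_mul, ← ENNReal.rpow_mul, ← ENNReal.rpow_add _ _ h0.ne' h1.ne,
      show s * (t / (s + t)) + -t * (s / (s + t)) = 0 by ring, ENNReal.rpow_zero]
  rw [hone] at key
  have h := ENNReal.rpow_le_rpow key (z := (s + t) / (s * t)) (by positivity)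
  rwa [ENNReal.one_rpow, ENNReal.mul_rpow_of_nonneg _ _ (by positivity), ← ENNReal.rpow_mul,
    ← ENNReal.rpow_mul, show t / (s + t) * ((s + t) / (s * t)) = s⁻¹ by field_simp,
    show s / (s + t) * ((s + t) / (s * t)) = t⁻¹ by field_simp] at h

lemma volume_cube_ne_zero {n : ℕ} (a : Fin n → ℝ) {ℓ : ℝ} (hℓ : 0 < ℓ) :
    volume (cube a ℓ) ≠ 0 := by
  simp [cube, Real.volume_Icc_pi, hℓ]

lemma volume_cube_ne_top {n : ℕ} (a : Fin n → ℝ) (ℓ : ℝ) : volume (cube a ℓ) ≠ ∞ :=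
  isCompact_Icc.measure_lt_top.ne

/-- The `L^s` average of a weight over a cube times the `L^t` average of its reciprocal is at
least `1`, for all exponents `s, t > 0`. -/
lemma IsWeight.one_le_setLAverage_mul {n : ℕ} {w : (Fin n → ℝ) → ℝ≥0∞} (hw : IsWeight w)
    (a : Fin n → ℝ) {ℓ : ℝ} (hℓ : 0 < ℓ) {s t : ℝ} (hs : 0 < s) (ht : 0 < t) :
    1 ≤ (⨍⁻ x in cube a ℓ, w x ^ s ∂volume) ^ s⁻¹ *
      (⨍⁻ x in cube a ℓ, w x ^ (-t) ∂volume) ^ t⁻¹ := by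
  have : IsProbabilityMeasure ((volume (cube a ℓ))⁻¹ • volume.restrict (cube a ℓ)) :=
    ⟨by simp [ENNReal.inv_mul_cancel (volume_cube_ne_zero a hℓ) (volume_cube_ne_top a ℓ)]⟩
  rw [setLAverage_eq', setLAverage_eq']
  exact one_le_lintegral_rpow_mul_lintegral_rpow_neg (hw.aemeasurable.restrict.smul_measure _)
    (Measure.ae_smul_measure (ae_restrict_of_ae hw.pos) _)
    (Measure.ae_smul_measure (ae_restrict_of_ae hw.lt_top) _) hs ht

lemma le_apConst {n : ℕ} (p : ℝ) (w : (Fin n → ℝ) → ℝ≥0∞) (a : Fin n → ℝ) {ℓ : ℝ}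
    (hℓ : 0 < ℓ) :
    (⨍⁻ x in cube a ℓ, w x ∂volume) *
      (⨍⁻ x in cube a ℓ, w x ^ (1 - Real.conjExponent p) ∂volume) ^ (p - 1) ≤ apConst p w :=
  le_iSup_of_le a (le_iSup_of_le ℓ (le_iSup_of_le hℓ le_rfl))

lemma one_sub_conjExponent {p : ℝ} (hp : 1 < p) :
    1 - Real.conjExponent p = -(p - 1)⁻¹ := by
  have : p - 1 ≠ 0 := (sub_pos.2 hp).ne'
  rw [Real.conjExponent]
  field_simp
  ring

/-- The `A_p` constant of a weight is controlled by the `A_q` constant of the weight and the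
`A_r` constant of its dual weight. -/
lemma apConst_le_mul {n : ℕ} {p q r : ℝ} (hp : 1 < p) (hq : 1 < q) (hr : 1 < r)
    {w : (Fin n → ℝ) → ℝ≥0∞} (hw : IsWeight w) :
    apConst p w ≤
      apConst q w * apConst r (fun x => w x ^ (1 - Real.conjExponent p)) ^ (p - 1) := by
  have hp0 : 0 < p - 1 := sub_pos.2 hp
  have hq0 : 0 < q - 1 := sub_pos.2 hq
  have hr0 : 0 < r - 1 := sub_pos.2 hr
  refine iSup_le fun a => iSup_le fun ℓ => iSup_le fun hℓ => ?_
  have h₁ := le_apConst q w a hℓ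
  have h₂ := ENNReal.rpow_le_rpow
    (le_apConst r (fun x => w x ^ (1 - Real.conjExponent p)) a hℓ) hp0.le
  -- `w ^ s = σ ^ (1 - r')` and `w ^ (-t) = w ^ (1 - q')`: the leftover factors of `h₂` and `h₁`.
  have h₃ := hw.one_le_setLAverage_mul a hℓ (s := ((r - 1) * (p - 1))⁻¹) (t := (q - 1)⁻¹)
    (by positivity) (by positivity)
  rw [ENNReal.mul_rpow_of_nonneg _ _ hp0.le, ← ENNReal.rpow_mul] at h₂
  simp only [← ENNReal.rpow_mul] at h₂
  rw [show (1 - Real.conjExponent p) * (1 - Real.conjExponent r) = ((r - 1) * (p - 1))⁻¹ by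
    rw [one_sub_conjExponent hp, one_sub_conjExponent hr, mul_inv]; ring] at h₂
  rw [one_sub_conjExponent hq] at h₁
  rw [inv_inv, inv_inv] at h₃
  refine (le_mul_of_one_le_right' h₃).trans ((le_of_eq ?_).trans (mul_le_mul' h₁ h₂))
  ring

end Muckenhoupt

theorem mainTheorem2 {n : ℕ} (p : ℝ) (hp : 1 < p) (w : (Fin n → ℝ) → ℝ≥0∞)
    (hw : Muckenhoupt.MemAInfty w)
    (hσ : Muckenhoupt.MemAInfty (fun x => w x ^ (1 - Real.conjExponent p))) :
    Muckenhoupt.MemAp p w := by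
  obtain ⟨q, hq, hwt, hwq⟩ := hw
  obtain ⟨r, hr, -, hσr⟩ := hσ
  exact ⟨hwt, (Muckenhoupt.apConst_le_mul hp hq hr hwt).trans_lt
    (ENNReal.mul_lt_top hwq (ENNReal.rpow_lt_top_of_nonneg (sub_pos.2 hp).le hσr.ne))⟩
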